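/- For $n\ge 1$, let $S_n$ be the set of permutations of $[n]=\{1,\dots,n\}$. An inversion of $w\in S_n$ is a pair $(i,j)$ with $1\le i<j\le n$ and $w^{-1}(i)>w^{-1}(j)$; the (right) weak order on $S_n$ is given by $u\le v$ if and only if every inversion of $u$ is an inversion of $v$. A permutation $w\in S_n$ is $312$-avoiding if there are no indices $i_1<i_2<i_3$ with $w(i_2)<w(i_3)<w(i_1)$. The Tamari lattice $\mathrm{Tam}_n$ is the set of $312$-avoiding permutations in $S_n$, ordered by the weak order. Let $L$ be a finite lattice. A nontrivial Ungar move sends an element $x\in L$ to the meet $\bigwedge(\{x\}\cup T)$ for some nonempty set $T$ of elements covered by $x$. In the Ungar game on $L$, two players, Atniss and Eeta, starting at the top element of $L$, alternately make nontrivial Ungar moves, with Atniss going first; the first player who cannot make a nontrivial Ungar move loses. The lattice $L$ is an Atniss win if Atniss has a winning strategy, and an Eeta win otherwise. An element $x\in L$ is an Eeta win in $L$ if the interval $[\hat 0,x]$ of $L$, where $\hat 0$ is the bottom element, is an Eeta win. For $u\in S_m$ and $v\in S_n$, the direct sum $u\oplus v\in S_{m+n}$ has one-line notation $u(1)\cdots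 u(m)\,(m+v(1))\cdots(m+v(n))$, and the skew sum $u\ominus v\in S_{m+n}$ has one-line notation $(n+u(1))\cdots(n+u(m))\,v(1)\cdots v(n)$. A permutation is decomposable if it is the direct sum of two smaller (nonempty) permutations, and indecomposable otherwise. Every permutation is uniquely a direct sum $u_1\oplus\cdots\oplus u_k$ of indecomposable permutations; these are its components. The standardization of a word of length $k$ with distinct entries is the permutation in $S_k$ obtained by replacing its $i$-th smallest entry with $i$ for all $i\in[k]$. Call $w\in\mathrm{Tam}_n$ even-districted if one of the following holds: 1. $n=1$; 2. $n\ge 3$, $w=w'\ominus 1$ for some $w'\in\mathrm{Tam}_{n-1}$ with an even number of components, and the standardization of $w(1)\cdots w(n-2)$ is an Eeta win in $\mathrm{Tam}_{n-2}$. **Proposition.** Let $n\ge 1$, and let $w\in\mathrm{Tam}_n$ be indecomposable. Then $w$ is an Eeta win in $\mathrm{Tam}_n$ if and only if $w$ is even-districted. -/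

import Mathlib

/-!
Conventions: a permutation in `S_n` is an element of `Equiv.Perm (Fin n)`, with positions and
values numbered from `0` to `n - 1` instead of `1` to `n`.
-/

/-! ### Ungar moves and Ungar games -/

section Ungar

variable {L : Type*} [PartialOrder L]

/-- The set `cov_L(x)` of the elements covered by `x`. -/
def coveredBy (x : L) : Set L := {y | y ⋖ x}

/-- `y` is obtained from `x` by a nontrivial Ungar move: `y` is the meet of `{x} ∪ T` for some
nonempty set `T` of elements covered by `x`. The meet is the greatest lower bound in `L`. -/
def IsNontrivialUngarMove (x y : L) : Prop :=
  ∃ T : Set L, T ⊆ coveredBy x ∧ T.Nonempty ∧ IsGLB ({x} ∪ T) y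

/-- The player whose turn it is at position `x` has a winning strategy (a player who cannot make a
nontrivial Ungar move loses). A derivation of `MoverWins x` is such a strategy: it names a move
`x → y`, and for every answer `y → z` of the opponent it contains a winning strategy from `z`. -/
inductive MoverWins : L → Prop
  | intro (x y : L) (move : IsNontrivialUngarMove x y)
      (answer : ∀ z : L, IsNontrivialUngarMove y z → MoverWins z) : MoverWins x

end Ungar

/-- The finite lattice `L` is an Atniss win: Atniss, who moves first starting from the top element,
has a winning strategy in the Ungar game on `L`. -/
def LatticeAtnissWin (L : Type*) [PartialOrder L] [OrderTop L] : Prop :=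
  MoverWins (⊤ : L)

/-- The element `x` of `L` is an Eeta win in `L`: the principal order ideal
`{y ∈ L : y ≤ x}` (the interval from the bottom element to `x`) is not an Atniss win. -/
def IsEetaWin {L : Type*} [PartialOrder L] (x : L) : Prop :=
  ¬ LatticeAtnissWin (Set.Iic x)

/-! ### The weak order and the Tamari lattice -/

/-- `(i, j)` is an inversion of `w`: `i < j` and the value `i` stands to the right of the
value `j`. -/
def IsInversion {n : ℕ} (w : Equiv.Perm (Fin n)) (i j : Fin n) : Prop :=
  i < j ∧ w.symm j < w.symm i

/-- The (right) weak order on `S_n`. -/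
def WeakLE {n : ℕ} (u v : Equiv.Perm (Fin n)) : Prop :=
  ∀ i j : Fin n, IsInversion u i j → IsInversion v i j

theorem WeakLE.antisymm {n : ℕ} {u v : Equiv.Perm (Fin n)} (h₁ : WeakLE u v) (h₂ : WeakLE v u) :
    u = v := by
  have key : ∀ i j : Fin n, u.symm i < u.symm j → v.symm i < v.symm j := by
    intro i j hij
    rcases lt_trichotomy i j with h | h | h
    · by_contra hc
      have hne : v.symm j ≠ v.symm i := fun e => h.ne' (v.symm.injective e)
      have := (h₂ i j ⟨h, lt_of_le_of_ne (not_lt.mp hc) hne⟩).2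
      exact absurd hij this.not_gt
    · subst h
      exact absurd hij (lt_irrefl _)
    · exact (h₁ j i ⟨h, hij⟩).2
  have hmono : StrictMono (fun k : Fin n => v.symm (u k)) := by
    intro a b hab
    exact key _ _ (by simpa using hab)
  have hid : (fun k : Fin n => v.symm (u k)) = id :=
    (StrictMono.range_inj hmono strictMono_id).mp
      ((v.symm.surjective.comp u.surjective).range_eq.trans Set.range_id.symm)
  ext k
  have := congrFun hid k
  simp only [id] at this
  rw [← v.symm_apply_eq.mp this]

/-- `w` is 312-avoiding. -/
def Avoids312 {n : ℕ} (w : Equiv.Perm (Fin n)) : Prop :=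
  ¬ ∃ i₁ i₂ i₃ : Fin n, i₁ < i₂ ∧ i₂ < i₃ ∧ w i₂ < w i₃ ∧ w i₃ < w i₁

/-- The `n`-th Tamari lattice: the 312-avoiding permutations in `S_n`, ordered by the weak
order. -/
def Tam (n : ℕ) : Type := {w : Equiv.Perm (Fin n) // Avoids312 w}

instance Tam.instPartialOrder (n : ℕ) : PartialOrder (Tam n) where
  le x y := WeakLE x.1 y.1
  le_refl _ _ _ h := h
  le_trans _ _ _ h₁ h₂ i j h := h₂ i j (h₁ i j h)
  le_antisymm _ _ h₁ h₂ := Subtype.ext (WeakLE.antisymm h₁ h₂)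

/-! ### Direct sums, skew sums, components, standardization -/

/-- Permutations of arbitrary size: pairs of a size `n` and an element of `S_n`. -/
abbrev SizedPerm : Type := Σ n : ℕ, Equiv.Perm (Fin n)

/-- The direct sum `u ⊕ v`: `u` on the first `u.1` positions and values, `v` shifted by `u.1` on
the remaining ones. -/
def directSum (u v : SizedPerm) : SizedPerm :=
  ⟨u.1 + v.1,
    (finSumFinEquiv.symm.trans (Equiv.sumCongr u.2 v.2)).trans finSumFinEquiv⟩

/-- The skew sum `u ⊖ v`: the first `u.1` positions carry the values of `u` shifted by `v.1`,
the remaining positions carry the values of `v`. -/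
def skewSum (u v : SizedPerm) : SizedPerm :=
  ⟨u.1 + v.1,
    (((finSumFinEquiv.symm.trans (Equiv.sumCongr u.2 v.2)).trans (Equiv.sumComm _ _)).trans
      finSumFinEquiv).trans (finCongr (Nat.add_comm v.1 u.1))⟩

/-- `w` is decomposable: it is the direct sum of two smaller permutations. -/
def Decomposable (w : SizedPerm) : Prop :=
  ∃ u v : SizedPerm, u.1 < w.1 ∧ v.1 < w.1 ∧ w = directSum u v

/-- `w` is indecomposable. Permutations have size at least `1` here: the empty permutation (the
unit of the direct sum) is not counted as indecomposable. -/
def Indecomposable (w : SizedPerm) : Prop :=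
  1 ≤ w.1 ∧ ¬ Decomposable w

/-- The direct sum `u₁ ⊕ ⋯ ⊕ u_k` of a list of permutations. -/
def directSumList (l : List SizedPerm) : SizedPerm :=
  l.foldr directSum ⟨0, Equiv.refl _⟩

/-- `l = [u₁, …, u_k]` is the list of components of `w`. -/
def IsComponents (w : SizedPerm) (l : List SizedPerm) : Prop :=
  (∀ u ∈ l, Indecomposable u) ∧ w = directSumList l

/-- `w` has an even number of components. -/
def HasEvenlyManyComponents (w : SizedPerm) : Prop :=
  ∃ l : List SizedPerm, IsComponents w l ∧ Even l.length

/-- The standardization of a word `x` with distinct entries, as a function: an entry is replaced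
by the number of entries smaller than it (values are numbered from `0`). -/
def standardizationFun {k : ℕ} (x : Fin k → ℕ) (i : Fin k) : Fin k :=
  ⟨(Finset.univ.filter fun j => x j < x i).card, by
    have h : (Finset.univ.filter fun j => x j < x i) ⊂ (Finset.univ : Finset (Fin k)) :=
      Finset.filter_ssubset.mpr ⟨i, Finset.mem_univ i, lt_irrefl _⟩
    simpa using Finset.card_lt_card h⟩

theorem standardizationFun_injective {k : ℕ} (x : Fin k → ℕ) (hx : Function.Injective x) :
    Function.Injective (standardizationFun x) := by
  have key : ∀ i j : Fin k, x i < x j → standardizationFun x i < standardizationFun x j := by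
    intro i j hij
    refine Fin.mk_lt_mk.mpr (Finset.card_lt_card ?_)
    refine Finset.ssubset_iff_of_subset ?_ |>.mpr ⟨i, by simpa using hij, by simp⟩
    intro a ha
    simp only [Finset.mem_filter, Finset.mem_univ, true_and] at ha ⊢
    exact ha.trans hij
  intro i j hij
  rcases lt_trichotomy (x i) (x j) with h | h | h
  · exact absurd hij (key i j h).ne
  · exact hx h
  · exact absurd hij (key j i h).ne'

/-- The standardization of a word with distinct entries, as a permutation. -/
noncomputable def standardization {k : ℕ} (x : Fin k → ℕ) (hx : Function.Injective x) :
    Equiv.Perm (Fin k) :=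
  Equiv.ofBijective (standardizationFun x)
    (Finite.injective_iff_bijective.mp (standardizationFun_injective x hx))

/-- The word formed by the first `n - 2` entries of `w`. -/
def dropLastTwo {n : ℕ} (w : Equiv.Perm (Fin n)) (i : Fin (n - 2)) : ℕ :=
  (w (Fin.castLE (Nat.sub_le n 2) i)).val

theorem dropLastTwo_injective {n : ℕ} (w : Equiv.Perm (Fin n)) :
    Function.Injective (dropLastTwo w) := fun _ _ h =>
  Fin.castLE_injective _ (w.injective (Fin.val_injective h))

/-- `w` is even-districted: either `n = 1`, or `n ≥ 3`, `w = w' ⊖ 1` for some `w'` in the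
`(n-1)`-st Tamari lattice with an even number of components, and the standardization of the first
`n - 2` entries of `w` is an Eeta win in the `(n-2)`-nd Tamari lattice. -/
def EvenDistricted {n : ℕ} (w : Tam n) : Prop :=
  n = 1 ∨
    (3 ≤ n ∧
      (∃ w' : Tam (n - 1),
        (⟨n, w.1⟩ : SizedPerm) = skewSum ⟨n - 1, w'.1⟩ ⟨1, Equiv.refl _⟩ ∧
        HasEvenlyManyComponents ⟨n - 1, w'.1⟩) ∧
      (∃ s : Tam (n - 2),
        s.1 = standardization (dropLastTwo w.1) (dropLastTwo_injective w.1) ∧ IsEetaWin s))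

/-!
The inversions `(i, j)` of a 312-avoiding permutation with a fixed `i` are those with
`i < j ≤ i + d i` for some number `d i`, and the intervals `[i, i + d i]` are nested or disjoint.
Hence such a permutation is a plane forest on its values, listed in postorder, with the values
numbered in preorder, where `d i` is the number of descendants of `i`
(`PlaneForest.exists_perm_eq`). Direct sums are concatenations of forests, so the components of the
permutation are the trees of the forest. The weak order compares the functions `d` pointwise
(`Tam.le_iff`), and the largest smaller value that `d i` can take while all other values are kept is
reached by detaching the last child of `i`. Therefore the lower covers of a forest arise by
detaching the last child of one node, and a nontrivial Ungar move does so for a nonempty set of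
nodes (`Tam.covBy_iff`, `Tam.isNontrivialUngarMove_iff`).

It remains to solve a game on forests. Let a forest be *losing* if all of its trees are, where a
tree is losing if it is a single node, or if its root has an even number of children and, with `c`
the last of them, the trees at the other children of the root and those at the children of `c` are
all losing. For the tree of an indecomposable permutation this is the condition of being
even-districted, because deleting the last two letters deletes the root and `c`
(`Tam.evenDistricted_iff`). The losing forests are the Eeta wins by two facts.

* A nontrivial move from a losing forest does not lead to a losing forest
  (`PlaneForest.Losing.eq_of_move`). This is proved by induction on the size, together with the
  statement that a losing forest with an odd number of trees cannot be moved to a forest `F'` such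
  that the tree with `F'` below its root is losing.
* Every forest has a (possibly trivial) move to a losing forest (`PlaneForest.exists_move_losing`).
  By induction this has to be shown for a single tree, and there one only has to control the parity
  of the number of children of the root, which is what
  `PlaneForest.exists_move_losing_tree_or_odd` does.
-/

/-! ### Plane forests and their moves -/

/-- Plane forests (finite sequences of plane trees), split off at the right end: `snoc F G` is the
forest `F` followed by one more tree, whose root has the trees of `G` as its children. -/
inductive PlaneForest : Type
  | nil : PlaneForest
  | snoc (F G : PlaneForest) : PlaneForest

namespace PlaneForest

/-- The number of nodes. -/
def size : PlaneForest → ℕ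
  | nil => 0
  | snoc F G => F.size + G.size + 1

/-- The number of trees. -/
def numTrees : PlaneForest → ℕ
  | nil => 0
  | snoc F _ => F.numTrees + 1

/-- Concatenation of forests. -/
def append (F : PlaneForest) : PlaneForest → PlaneForest
  | nil => F
  | snoc A B => snoc (append F A) B

/-- `Move F F'`: the forest `F'` arises from `F` by choosing a possibly empty set of nodes that have
children, and detaching from each of them its last child (as a node of `F`), which becomes the next
sibling to the right of its former parent. In the constructor `detach` the root of the last tree is
chosen; its last child is the root of `snoc nil H`. -/
inductive Move : PlaneForest → PlaneForest → Prop
  | nil : Move nil nil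
  | keep {F F' G G' : PlaneForest} : Move F F' → Move G G' → Move (snoc F G) (snoc F' G')
  | detach {F F' G G' H X : PlaneForest} : Move F F' → Move G G' → Move (snoc nil H) X →
      Move (snoc F (snoc G H)) (append (snoc F' G') X)

/-- The forests that are lost for the player to move: those all of whose trees are either a single
node, or have a root with an even number of children such that every child but the last spawns a
losing tree, and so does every child of the last child. -/
def Losing : PlaneForest → Prop
  | nil => True
  | snoc F nil => F.Losing
  | snoc F (snoc A B) => F.Losing ∧ Odd A.numTrees ∧ A.Losing ∧ B.Losing

@[simp] theorem size_append (F G : PlaneForest) : (F.append G).size = F.size + G.size := by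
  induction G with
  | nil => rfl
  | snoc A B ihA _ => simp only [append, size, ihA]; omega

@[simp] theorem numTrees_append (F G : PlaneForest) :
    (F.append G).numTrees = F.numTrees + G.numTrees := by
  induction G with
  | nil => rfl
  | snoc A B ihA _ => simp only [append, numTrees, ihA]; omega

theorem append_assoc (F G H : PlaneForest) :
    (F.append G).append H = F.append (G.append H) := by
  induction H with
  | nil => rfl
  | snoc A B ihA _ => simp only [append, ihA]

theorem snoc_append (F G H : PlaneForest) :
    (snoc F G).append H = F.append ((snoc nil G).append H) := by
  rw [← append_assoc]; rfl

theorem losing_snoc (F G : PlaneForest) :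
    (snoc F G).Losing ↔ F.Losing ∧ (snoc nil G).Losing := by
  cases G <;> simp [Losing]

@[simp] theorem losing_append (F G : PlaneForest) :
    (F.append G).Losing ↔ F.Losing ∧ G.Losing := by
  induction G with
  | nil => simp [append, Losing]
  | snoc A B ihA _ => rw [append, losing_snoc, ihA, losing_snoc A, and_assoc]

theorem losing_tree_snoc (A B : PlaneForest) :
    (snoc nil (snoc A B)).Losing ↔ Odd A.numTrees ∧ A.Losing ∧ B.Losing := by
  simp [Losing]

namespace Move

theorem refl (F : PlaneForest) : Move F F := by
  induction F with
  | nil => exact .nil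
  | snoc _ _ ihF ihG => exact .keep ihF ihG

theorem size_eq {F F' : PlaneForest} (h : Move F F') : F'.size = F.size := by
  induction h with
  | nil => rfl
  | keep _ _ ih₁ ih₂ => simp only [size, ih₁, ih₂]
  | detach _ _ _ ih₁ ih₂ ih₃ => simp only [size_append, size, ih₁, ih₂, ih₃]; omega

theorem append_tree {F F' G X : PlaneForest} (hF : Move F F')
    (h : Move (snoc PlaneForest.nil G) X) :
    Move (snoc F G) (F'.append X) := by
  cases h with
  | keep h₁ h₂ =>
    cases h₁
    exact .keep hF h₂
  | detach h₁ h₂ h₃ =>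
    cases h₁
    rw [← snoc_append]
    exact .detach hF h₂ h₃

/-- A move turns a nonempty forest into a nonempty forest. -/
theorem exists_eq_snoc {F G X : PlaneForest} (h : Move (snoc F G) X) :
    ∃ A B, X = snoc A B := by
  cases X with
  | nil => have := h.size_eq; simp [size] at this
  | snoc A B => exact ⟨A, B, rfl⟩

end Move

/-! ### Losing forests have no move to losing forests -/

/-- The two properties of a forest that have to be proved by a simultaneous induction: a nontrivial
move does not preserve `Losing`; and if a losing forest has an odd number of trees, no move makes it
the forest of children of the root of a losing tree. -/
def Rigid (F : PlaneForest) : Prop :=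
  F.Losing →
    (∀ F', Move F F' → F'.Losing → F' = F) ∧
    (Odd F.numTrees → ∀ F', Move F F' → ¬ (snoc nil F').Losing)

/-- A nontrivial move that does not choose the root of a losing tree does not lead to a losing tree.
In the critical case, a node is detached from the last child of the root. The parity of the number of
children of the root then forces the detached node to be chosen as well, and this leaves behind a
losing tree whose children come from a losing forest with an odd number of trees. -/
theorem rigid_tree {G : PlaneForest} (ih : ∀ F : PlaneForest, F.size < G.size → Rigid F)
    (hG : (snoc nil G).Losing) {G' : PlaneForest} (h : Move G G') (hG' : (snoc nil G').Losing) :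
    G' = G := by
  cases h with
  | nil => rfl
  | @keep A A' B B' hA hB =>
    rw [losing_tree_snoc] at hG hG'
    rw [(ih A (by simp only [size]; omega) hG.2.1).1 _ hA hG'.2.1,
      (ih B (by simp only [size]; omega) hG.2.2).1 _ hB hG'.2.2]
  | @detach A A' B B' J Y hA hB hJ =>
    exfalso
    rw [losing_tree_snoc] at hG
    obtain ⟨hodd, hAl, hBJ⟩ := hG
    cases hJ with
    | @keep N _ _ J' hN hJ =>
      cases hN
      simp only [append, losing_tree_snoc, losing_snoc A', numTrees] at hG'
      rw [(ih A (by simp only [size]; omega) hAl).1 _ hA hG'.2.1.1] at hG'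
      have := hG'.1
      grind
    | @detach N _ J₁ J₁' J₂ Z hN hJ₁ hJ₂ =>
      cases hN
      obtain ⟨Z₁, Z₂, rfl⟩ := hJ₂.exists_eq_snoc
      simp only [append, losing_tree_snoc, losing_append] at hG'
      rw [losing_snoc, losing_tree_snoc] at hBJ
      exact (ih J₁ (by simp only [size]; omega) hBJ.2.2.1).2 hBJ.2.1 _ hJ₁ hG'.2.1.2.1

theorem rigid (F : PlaneForest) : Rigid F := by
  induction hn : F.size using Nat.strong_induction_on generalizing F with
  | _ n ih =>
    have ih : ∀ A : PlaneForest, A.size < F.size → Rigid A := fun A hA => ih _ (hn ▸ hA) A rfl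
    intro hF
    refine ⟨fun F' h hF' => ?_, fun hodd F' h hF' => ?_⟩
    · cases h with
      | nil => rfl
      | @keep A A' B B' hA hB =>
        rw [losing_snoc] at hF hF'
        rw [(ih A (by simp only [size]; omega) hF.1).1 _ hA hF'.1,
          rigid_tree (fun C hC => ih C (by simp only [size]; omega)) hF.2 hB hF'.2]
      | @detach A A' B B' J Y hA hB hJ =>
        rw [losing_snoc, losing_tree_snoc] at hF
        rw [losing_append, losing_snoc] at hF'
        exact absurd hF'.1.2
          ((ih B (by simp only [size]; omega) hF.2.2.1).2 hF.2.1 _ hB)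
    · cases h with
      | nil => simp [numTrees] at hodd
      | @keep A A' B B' hA hB =>
        rw [losing_snoc] at hF
        rw [losing_tree_snoc] at hF'
        rw [(ih A (by simp only [size]; omega) hF.1).1 _ hA hF'.2.1] at hF'
        simp only [numTrees] at hodd
        have := hF'.1
        grind
      | @detach A A' B B' J Y hA hB hJ =>
        obtain ⟨Z₁, Z₂, rfl⟩ := hJ.exists_eq_snoc
        simp only [append, losing_tree_snoc, losing_append] at hF'
        rw [losing_snoc] at hF'
        rw [losing_snoc, losing_tree_snoc] at hF
        exact (ih B (by simp only [size]; omega) hF.2.2.1).2 hF.2.1 _ hB hF'.2.1.1.2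

theorem Losing.eq_of_move {F F' : PlaneForest} (hF : F.Losing) (h : Move F F') (hF' : F'.Losing) :
    F' = F :=
  (rigid F hF).1 F' h hF'

/-! ### Every forest has a move to a losing forest -/

/-- If forests up to the size of `F` can be moved to losing ones, then `F` can be turned into the
children of the root of a losing tree, or else into a losing forest with an odd number of trees. -/
theorem exists_move_losing_tree_or_odd (F : PlaneForest)
    (ih : ∀ A : PlaneForest, A.size ≤ F.size → ∃ A', Move A A' ∧ A'.Losing) :
    ∃ F', Move F F' ∧ ((snoc nil F').Losing ∨ F'.Losing ∧ Odd F'.numTrees) := by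
  cases F with
  | nil => exact ⟨nil, .nil, .inl (by simp [Losing])⟩
  | snoc A Y =>
    obtain ⟨A', hA, hA'⟩ := ih A (by simp only [size]; omega)
    rcases Nat.even_or_odd A'.numTrees with heven | hodd
    · obtain ⟨B, hB, hB'⟩ := ih (snoc nil Y) (by simp only [size]; omega)
      rcases Nat.even_or_odd B.numTrees with hBe | hBo
      · cases hB with
        | keep h _ =>
          cases h
          simp [numTrees] at hBe
        | @detach _ _ Y₁ Y₁' Z X h hY hZ =>
          -- The root of the last tree is detached from its last child `Z`, and `Z` is left whole
          -- with losing children: this corrects the parity.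
          cases h
          obtain ⟨K, hK, hK'⟩ := ih Z (by simp only [size]; omega)
          refine ⟨_, .detach hA hY (.keep .nil hK), .inl ?_⟩
          rw [losing_append, losing_snoc] at hB'
          simp only [append, losing_tree_snoc, losing_snoc A', numTrees]
          exact ⟨heven.add_one, ⟨hA', hB'.1.2⟩, hK'⟩
      · exact ⟨_, hA.append_tree hB, .inr ⟨by simp [hA', hB'], by
          rw [numTrees_append]; exact heven.add_odd hBo⟩⟩
    · obtain ⟨Y', hY, hY'⟩ := ih Y (by simp only [size]; omega)
      exact ⟨_, .keep hA hY, .inl ((losing_tree_snoc _ _).2 ⟨hodd, hA', hY'⟩)⟩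

theorem exists_move_losing (F : PlaneForest) : ∃ F', Move F F' ∧ F'.Losing := by
  induction hn : F.size using Nat.strong_induction_on generalizing F with
  | _ n ih =>
    have ih : ∀ A : PlaneForest, A.size < F.size → ∃ A', Move A A' ∧ A'.Losing :=
      fun A hA => ih _ (hn ▸ hA) A rfl
    cases F with
    | nil => exact ⟨nil, .nil, trivial⟩
    | snoc F G =>
      obtain ⟨F', hF, hF'⟩ := ih F (by simp only [size]; omega)
      suffices ∃ X, Move (snoc nil G) X ∧ X.Losing by
        obtain ⟨X, hX, hX'⟩ := this
        exact ⟨_, hF.append_tree hX, (losing_append _ _).2 ⟨hF', hX'⟩⟩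
      cases G with
      | nil => exact ⟨_, Move.refl _, by simp [Losing]⟩
      | snoc A B =>
        obtain ⟨A', hA, hA'⟩ := exists_move_losing_tree_or_odd A
          fun C hC => ih C (by simp only [size]; omega)
        rcases hA' with hA' | ⟨hA', hodd⟩
        · obtain ⟨X, hX, hX'⟩ := ih (snoc nil B) (by simp only [size]; omega)
          exact ⟨_, .detach .nil hA hX, (losing_append _ _).2 ⟨hA', hX'⟩⟩
        · obtain ⟨B', hB, hB'⟩ := ih B (by simp only [size]; omega)
          exact ⟨_, .keep .nil (.keep hA hB), (losing_tree_snoc _ _).2 ⟨hodd, hA', hB'⟩⟩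

end PlaneForest

/-! ### Numbers of descendants -/

namespace PlaneForest

/-- `F.desc i` is the number of descendants of the node `i` of `F`, where the nodes are numbered
from `0` in preorder; it is `0` if there is no node `i`. The descendants of `i` are the nodes
`i + 1, …, i + F.desc i`. -/
def desc : PlaneForest → ℕ → ℕ
  | nil, _ => 0
  | snoc F G, i => if i < F.size then F.desc i else if i = F.size then G.size
      else G.desc (i - F.size - 1)

/-- The number of nodes outside of the last tree. -/
def sizeInit : PlaneForest → ℕ
  | nil => 0
  | snoc F _ => F.size

@[simp] theorem sizeInit_snoc (F G : PlaneForest) : (snoc F G).sizeInit = F.size := rfl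

/-- `F.shortDesc i` is the number of descendants of the node `i` after the removal of its last
child; it is `0` if `i` has no child. -/
def shortDesc : PlaneForest → ℕ → ℕ
  | nil, _ => 0
  | snoc F G, i => if i < F.size then F.shortDesc i else if i = F.size then G.sizeInit
      else G.shortDesc (i - F.size - 1)

theorem desc_add_lt (F : PlaneForest) {i : ℕ} (hi : i < F.size) : i + F.desc i < F.size := by
  induction F generalizing i with
  | nil => exact hi
  | snoc F G ihF ihG =>
    simp only [size, desc] at hi ⊢
    split_ifs with h₁ h₂
    · have := ihF h₁; omega
    · omega
    · have := @ihG (i - F.size - 1) (by omega); omega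

theorem desc_of_size_le (F : PlaneForest) {i : ℕ} (hi : F.size ≤ i) : F.desc i = 0 := by
  induction F generalizing i with
  | nil => rfl
  | snoc F G ihF ihG =>
    simp only [size] at hi
    simp only [desc]
    rw [if_neg (by omega), if_neg (by omega), ihG (by omega)]

/-- The descendants of a descendant are descendants. -/
theorem desc_nested (F : PlaneForest) {i k : ℕ} (hik : i < k) (hk : k ≤ i + F.desc i) :
    k + F.desc k ≤ i + F.desc i := by
  induction F generalizing i k with
  | nil => simp only [desc] at hk; omega
  | snoc F G ihF ihG =>
    simp only [desc] at hk ⊢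
    split_ifs at hk with h₁ h₂
    · have := F.desc_add_lt h₁
      rw [if_pos (by omega), if_pos h₁]
      exact ihF hik hk
    · rw [if_neg (by omega), if_neg (by omega), if_neg h₁, if_pos h₂]
      have := G.desc_add_lt (i := k - F.size - 1) (by omega)
      omega
    · rw [if_neg (by omega), if_neg (by omega), if_neg h₁, if_neg h₂]
      have := @ihG (i - F.size - 1) (k - F.size - 1) (by omega) (by omega)
      omega

theorem desc_append (F G : PlaneForest) (i : ℕ) :
    (F.append G).desc i = if i < F.size then F.desc i else G.desc (i - F.size) := by
  induction G generalizing i with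
  | nil =>
    simp only [append, desc]
    split_ifs with h
    · rfl
    · exact F.desc_of_size_le (by omega)
  | snoc A B ihA _ =>
    simp only [append, desc, size_append, ihA]
    by_cases h₁ : i < F.size
    · simp [h₁, Nat.lt_add_right]
    · have e₁ : i < F.size + A.size ↔ i - F.size < A.size := by omega
      have e₂ : i = F.size + A.size ↔ i - F.size = A.size := by omega
      have e₃ : i - (F.size + A.size) - 1 = i - F.size - A.size - 1 := by omega
      simp only [h₁, e₁, e₂, e₃, if_false]

theorem size_sizeInit_lt {G : PlaneForest} (hG : 0 < G.size) : G.sizeInit < G.size := by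
  cases G with
  | nil => exact hG
  | snoc A B => simp only [sizeInit, size]; omega

theorem shortDesc_le (F : PlaneForest) (i : ℕ) : F.shortDesc i ≤ F.desc i := by
  induction F generalizing i with
  | nil => exact le_rfl
  | snoc F G ihF ihG =>
    simp only [desc, shortDesc]
    split_ifs
    · exact ihF i
    · cases G
      · exact le_rfl
      · simp only [sizeInit, size]; omega
    · exact ihG _

theorem shortDesc_lt (F : PlaneForest) {i : ℕ} (h : 0 < F.desc i) : F.shortDesc i < F.desc i := by
  induction F generalizing i with
  | nil => exact h
  | snoc F G ihF ihG =>
    simp only [desc, shortDesc] at h ⊢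
    split_ifs at h ⊢
    · exact ihF h
    · exact size_sizeInit_lt h
    · exact ihG h

/-- The last child of a node has the same last descendant as the node itself. -/
theorem desc_last_child (F : PlaneForest) {i : ℕ} (h : 0 < F.desc i) :
    i + F.shortDesc i + 1 + F.desc (i + F.shortDesc i + 1) = i + F.desc i := by
  induction F generalizing i with
  | nil => simp [desc] at h
  | snoc F G ihF ihG =>
    simp only [desc, shortDesc] at h ⊢
    split_ifs at h ⊢ with h₁ h₂ h₃ h₄ h₅ h₆ h₇
    all_goals try omega
    · exact ihF h
    · have := F.shortDesc_lt h
      have := F.desc_add_lt h₁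
      omega
    · have := F.shortDesc_lt h
      have := F.desc_add_lt h₁
      omega
    · obtain rfl : i = F.size := by omega
      cases G with
      | nil => simp [size] at h
      | snoc A B =>
        simp only [sizeInit]
        rw [show F.size + A.size + 1 - F.size - 1 = A.size by omega]
        simp only [desc, size]
        simp
        omega
    · have := ihG h
      rw [show i + G.shortDesc (i - F.size - 1) + 1 - F.size - 1 =
        i - F.size - 1 + G.shortDesc (i - F.size - 1) + 1 by omega]
      omega

/-- A forest is determined by its size and the numbers of descendants of its nodes. -/
theorem eq_of_desc_eq {F F' : PlaneForest} (hs : F.size = F'.size) (h : ∀ i, F.desc i = F'.desc i) :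
    F = F' := by
  induction F generalizing F' with
  | nil =>
    cases F' with
    | nil => rfl
    | snoc => simp [size] at hs
  | snoc F G ihF ihG =>
    cases F' with
    | nil => simp [size] at hs
    | snoc F' G' =>
      -- The root of the last tree is the first node which has the last node as its last descendant.
      have h₁ := h F.size
      have h₂ := h F'.size
      simp only [size, desc] at hs h₁ h₂
      have hF : F.size = F'.size := by
        rcases lt_trichotomy F.size F'.size with hlt | heq | hlt
        · have := F'.desc_add_lt hlt
          simp [hlt] at h₁
          omega
        · exact heq
        · have := F.desc_add_lt hlt
          simp [hlt] at h₂
          omega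
      have hG : G.size = G'.size := by omega
      congr 1
      · refine ihF hF fun i => ?_
        by_cases hi : i < F.size
        · have := h i
          simpa [desc, hi, hF ▸ hi] using this
        · rw [desc_of_size_le _ (by omega), desc_of_size_le _ (by omega)]
      · refine ihG hG fun i => ?_
        have := h (F.size + i + 1)
        simp only [desc, ← hF] at this
        rwa [if_neg (by omega), if_neg (by omega), if_neg (by omega), if_neg (by omega),
          show F.size + i + 1 - F.size - 1 = i by omega] at this

/-- The numbers of descendants of the nodes of a forest can be prescribed, as soon as descendants of
descendants are descendants. -/
theorem exists_desc_eq (n : ℕ) (d : ℕ → ℕ) (hd : ∀ i, i < n → i + d i < n)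
    (hnest : ∀ i k, i < k → k ≤ i + d i → k + d k ≤ i + d i) :
    ∃ F : PlaneForest, F.size = n ∧ ∀ i, i < n → F.desc i = d i := by
  induction n using Nat.strong_induction_on generalizing d with
  | _ n ih =>
    rcases Nat.eq_zero_or_pos n with rfl | hn
    · exact ⟨nil, rfl, by simp⟩
    have hex : ∃ p, p < n ∧ p + d p = n - 1 :=
      ⟨n - 1, by omega, by have := hd (n - 1) (by omega); omega⟩
    classical
    obtain ⟨hp, hpd⟩ := Nat.find_spec hex
    have hmin : ∀ i, i < Nat.find hex → ¬ (i < n ∧ i + d i = n - 1) := fun i => Nat.find_min hex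
    generalize Nat.find hex = p at hp hpd hmin
    obtain ⟨F, hF, hF'⟩ := ih p hp d (fun i hi => by
      by_contra hc
      have := hnest i p hi (by omega)
      have := hd i (by omega)
      exact hmin i hi ⟨by omega, by omega⟩) hnest
    obtain ⟨G, hG, hG'⟩ := ih (n - p - 1) (by omega) (fun i => d (p + 1 + i))
      (fun i hi => by have := hd (p + 1 + i) (by omega); omega)
      (fun i k hik hk => by have := hnest (p + 1 + i) (p + 1 + k) (by omega) (by omega); omega)
    refine ⟨snoc F G, by simp only [size]; omega, fun i hi => ?_⟩
    simp only [desc]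
    split_ifs with h₁ h₂
    · exact hF' i (by omega)
    · rw [h₂, hF]; omega
    · rw [hG' _ (by omega)]
      congr 1
      omega

/-! ### Moves in terms of the numbers of descendants -/

/-- Any set of nodes can be chosen for a move, and the move replaces `desc` by `shortDesc` at the
chosen nodes. -/
theorem exists_move_desc_eq (F : PlaneForest) (S : Set ℕ) [DecidablePred (· ∈ S)] :
    ∃ F', Move F F' ∧ ∀ i, F'.desc i = if i ∈ S then F.shortDesc i else F.desc i := by
  induction hn : F.size using Nat.strong_induction_on generalizing F S with
  | _ n ih =>
    subst hn
    cases F with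
    | nil => exact ⟨nil, .nil, by simp [desc, shortDesc]⟩
    | snoc F G =>
      obtain ⟨F', hF, hF'⟩ := ih F.size (by simp only [size]; omega) F S rfl
      have hFs := hF.size_eq
      by_cases hS : F.size ∈ S ∧ ∃ A B, G = snoc A B
      · obtain ⟨hS, A, B, rfl⟩ := hS
        obtain ⟨A', hA, hA'⟩ := ih A.size (by simp only [size]; omega) A
          {i | F.size + 1 + i ∈ S} rfl
        obtain ⟨X, hX, hX'⟩ := ih (snoc nil B).size (by simp only [size]; omega) (snoc nil B)
          {i | F.size + 1 + A.size + i ∈ S} rfl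
        have hAs := hA.size_eq
        refine ⟨_, .detach hF hA hX, fun i => ?_⟩
        have e : i - (F.size + A.size + 1) = i - F.size - 1 - A.size := by omega
        simp only [desc_append, desc, shortDesc, size, hFs, hAs, hF', hA', hX', sizeInit_snoc, e,
          Set.mem_ofPred_eq]
        rcases lt_trichotomy i F.size with h | h | h
        · simp only [h, if_true, if_pos (show i < F.size + A.size + 1 by omega)]
        · subst h
          simp only [hS, lt_irrefl, if_true, if_false,
            if_pos (show F.size < F.size + A.size + 1 by omega)]
        · have h₁ : ¬ i < F.size := by omega
          have h₂ : ¬ i = F.size := by omega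
          have e₁ : i < F.size + A.size + 1 ↔ i - F.size - 1 < A.size := by omega
          simp only [h₁, h₂, if_false, e₁]
          by_cases h₃ : i - F.size - 1 < A.size
          · simp only [h₃, if_true, show F.size + 1 + (i - F.size - 1) = i by omega]
          · have e₂ : i - F.size - 1 - A.size = 0 ↔ i - F.size - 1 = A.size := by omega
            simp only [h₃, if_false, Nat.not_lt_zero, e₂, Nat.sub_zero,
              show F.size + 1 + A.size + (i - F.size - 1 - A.size) = i by omega]
      · obtain ⟨G', hG, hG'⟩ := ih G.size (by simp only [size]; omega) G
          {i | F.size + 1 + i ∈ S} rfl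
        have hGs := hG.size_eq
        refine ⟨_, .keep hF hG, fun i => ?_⟩
        simp only [desc, shortDesc, hFs, hGs, hF', hG', Set.mem_ofPred_eq]
        rcases lt_trichotomy i F.size with h | h | h
        · simp only [h, if_true]
        · subst h
          simp only [lt_irrefl, if_true, if_false]
          split_ifs with h
          · cases G with
            | nil => rfl
            | snoc A B => exact absurd ⟨h, A, B, rfl⟩ hS
          · rfl
        · have h₁ : ¬ i < F.size := by omega
          have h₂ : ¬ i = F.size := by omega
          simp only [h₁, h₂, if_false, show F.size + 1 + (i - F.size - 1) = i by omega]

theorem Move.desc_eq_or {F F' : PlaneForest} (h : Move F F') (i : ℕ) :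
    F'.desc i = F.desc i ∨ F'.desc i = F.shortDesc i := by
  induction h generalizing i with
  | nil => exact .inl rfl
  | @keep F F' G G' hF hG ihF ihG =>
    simp only [desc, shortDesc, hF.size_eq, hG.size_eq]
    split_ifs
    · exact ihF i
    · exact .inl rfl
    · exact ihG _
  | @detach F F' A A' B X hF hA hX ihF ihA ihX =>
    have hFs := hF.size_eq
    have hAs := hA.size_eq
    have e : i - (F.size + A.size + 1) = i - F.size - 1 - A.size := by omega
    simp only [desc_append, desc, shortDesc, size, hFs, hAs, sizeInit_snoc, e]
    rcases lt_trichotomy i F.size with h | h | h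
    · simp only [h, if_true, if_pos (show i < F.size + A.size + 1 by omega)]
      exact ihF i
    · subst h
      simp only [lt_irrefl, if_true, if_false,
        if_pos (show F.size < F.size + A.size + 1 by omega), or_true]
    · have h₁ : ¬ i < F.size := by omega
      have h₂ : ¬ i = F.size := by omega
      have e₁ : i < F.size + A.size + 1 ↔ i - F.size - 1 < A.size := by omega
      simp only [h₁, h₂, if_false, e₁]
      by_cases h₃ : i - F.size - 1 < A.size
      · simp only [h₃, if_true]
        exact ihA _
      · have e₂ : i - F.size - 1 - A.size = 0 ↔ i - F.size - 1 = A.size := by omega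
        have := ihX (i - F.size - 1 - A.size)
        simpa only [h₃, if_false, Nat.not_lt_zero, e₂, Nat.sub_zero, desc, shortDesc, size]
          using this

end PlaneForest

/-! ### Permutations of arbitrary size -/

namespace SizedPerm

/-- The entry of `w` at the position `i`, and `i` if there is no such position. -/
def val (w : SizedPerm) (i : ℕ) : ℕ := if h : i < w.1 then w.2 ⟨i, h⟩ else i

/-- The position of the value `i` in `w`, and `i` if there is no such value. -/
def pos (w : SizedPerm) (i : ℕ) : ℕ := if h : i < w.1 then w.2.symm ⟨i, h⟩ else i

/-- `(i, j)` is an inversion of `w`, for natural numbers `i` and `j`. -/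
def HasInv (w : SizedPerm) (i j : ℕ) : Prop := i < j ∧ j < w.1 ∧ pos w j < pos w i

/-- The permutation of size one. -/
def one : SizedPerm := ⟨1, Equiv.refl _⟩

theorem val_fin (w : SizedPerm) (i : Fin w.1) : val w i = w.2 i := by simp [val]

theorem pos_fin (w : SizedPerm) (i : Fin w.1) : pos w i = w.2.symm i := by simp [pos]

theorem pos_lt (w : SizedPerm) {i : ℕ} (h : i < w.1) : pos w i < w.1 := by
  simp [pos, h]

theorem pos_injective (w : SizedPerm) {i j : ℕ} (hi : i < w.1) (hj : j < w.1)
    (h : pos w i = pos w j) : i = j := by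
  simpa [pos, hi, hj, Fin.val_inj] using h

theorem inv_fin (w : SizedPerm) (i j : Fin w.1) : HasInv w i j ↔ IsInversion w.2 i j := by
  simp [HasInv, IsInversion, pos_fin]

theorem ext_val {u v : SizedPerm} (hs : u.1 = v.1) (h : ∀ i < u.1, val u i = val v i) : u = v := by
  obtain ⟨n, u⟩ := u
  obtain ⟨m, v⟩ := v
  obtain rfl : n = m := hs
  congr 1
  ext i
  have := h i i.2
  rwa [val_fin ⟨n, u⟩ i, val_fin ⟨n, v⟩ i] at this

theorem ext_inv {u v : SizedPerm} (hs : u.1 = v.1)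
    (h : ∀ i j, HasInv u i j ↔ HasInv v i j) : u = v := by
  obtain ⟨n, u⟩ := u
  obtain ⟨m, v⟩ := v
  obtain rfl : n = m := hs
  congr 1
  exact WeakLE.antisymm
    (fun i j hij => (inv_fin ⟨n, v⟩ i j).1 ((h _ _).1 ((inv_fin ⟨n, u⟩ i j).2 hij)))
    (fun i j hij => (inv_fin ⟨n, u⟩ i j).1 ((h _ _).2 ((inv_fin ⟨n, v⟩ i j).2 hij)))

@[simp] theorem directSum_fst (u v : SizedPerm) : (directSum u v).1 = u.1 + v.1 := rfl

@[simp] theorem skewSum_fst (u v : SizedPerm) : (skewSum u v).1 = u.1 + v.1 := rfl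

theorem val_directSum (u v : SizedPerm) (i : ℕ) :
    val (directSum u v) i = if i < u.1 then val u i else u.1 + val v (i - u.1) := by
  by_cases h : i < u.1 + v.1
  · have key : ∀ k : Fin (u.1 + v.1),
        (finSumFinEquiv (Sum.map u.2 v.2 (finSumFinEquiv.symm k)) : ℕ) =
        if (k : ℕ) < u.1 then val u k else u.1 + val v (k - u.1) := by
      intro k
      induction k using Fin.addCases with
      | left k => simp [val_fin]
      | right k => simp [val_fin]
    exact (val_fin (directSum u v) ⟨i, h⟩).trans (key ⟨i, h⟩)
  · rw [val, dif_neg (show ¬ i < (directSum u v).1 from h), if_neg (by omega), val,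
      dif_neg (by omega)]
    omega

theorem pos_directSum (u v : SizedPerm) (i : ℕ) :
    pos (directSum u v) i = if i < u.1 then pos u i else u.1 + pos v (i - u.1) := by
  by_cases h : i < u.1 + v.1
  · have key : ∀ k : Fin (u.1 + v.1),
        (finSumFinEquiv (Sum.map u.2.symm v.2.symm (finSumFinEquiv.symm k)) : ℕ) =
        if (k : ℕ) < u.1 then pos u k else u.1 + pos v (k - u.1) := by
      intro k
      induction k using Fin.addCases with
      | left k => simp [pos_fin]
      | right k => simp [pos_fin]
    exact (pos_fin (directSum u v) ⟨i, h⟩).trans (key ⟨i, h⟩)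
  · rw [pos, dif_neg (show ¬ i < (directSum u v).1 from h), if_neg (by omega), pos,
      dif_neg (by omega)]
    omega

theorem val_skewSum (u v : SizedPerm) {i : ℕ} (h : i < u.1 + v.1) :
    val (skewSum u v) i = if i < u.1 then v.1 + val u i else val v (i - u.1) := by
  have key : ∀ k : Fin (u.1 + v.1),
      (finSumFinEquiv (Sum.map u.2 v.2 (finSumFinEquiv.symm k)).swap : ℕ) =
      if (k : ℕ) < u.1 then v.1 + val u k else val v (k - u.1) := by
    intro k
    induction k using Fin.addCases with
    | left k => simp [val_fin]
    | right k => simp [val_fin]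
  exact (val_fin (skewSum u v) ⟨i, h⟩).trans (key ⟨i, h⟩)

theorem pos_skewSum (u v : SizedPerm) {i : ℕ} (h : i < u.1 + v.1) :
    pos (skewSum u v) i = if i < v.1 then u.1 + pos v i else pos u (i - v.1) := by
  have key : ∀ k : Fin (v.1 + u.1),
      (finSumFinEquiv (Sum.map u.2.symm v.2.symm (finSumFinEquiv.symm k).swap) : ℕ) =
      if (k : ℕ) < v.1 then u.1 + pos v k else pos u (k - v.1) := by
    intro k
    induction k using Fin.addCases with
    | left k => simp [pos_fin]
    | right k => simp [pos_fin]
  exact (pos_fin (skewSum u v) ⟨i, h⟩).trans (key ⟨i, by omega⟩)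

theorem inv_directSum (u v : SizedPerm) (i j : ℕ) :
    HasInv (directSum u v) i j ↔ HasInv u i j ∨ u.1 ≤ i ∧ HasInv v (i - u.1) (j - u.1) := by
  simp only [HasInv, pos_directSum, directSum_fst]
  by_cases hi : i < u.1 <;> by_cases hj : j < u.1
  · rw [if_pos hi, if_pos hj]; omega
  · have := u.pos_lt hi
    rw [if_pos hi, if_neg hj]; omega
  · omega
  · rw [if_neg hi, if_neg hj]; omega

theorem inv_skewSum_one (u : SizedPerm) (i j : ℕ) :
    HasInv (skewSum u one) i j ↔ i = 0 ∧ 0 < j ∧ j ≤ u.1 ∨ 0 < i ∧ HasInv u (i - 1) (j - 1) := by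
  by_cases hj : j < u.1 + 1
  · by_cases hij : i < j
    · simp only [HasInv, skewSum_fst]
      rw [pos_skewSum u one (show i < u.1 + one.1 by change i < u.1 + 1; omega),
        pos_skewSum u one (show j < u.1 + one.1 from hj)]
      simp only [show one.1 = 1 from rfl]
      rw [if_neg (by omega)]
      split_ifs with hi
      · have := u.pos_lt (i := j - 1) (by omega)
        omega
      · omega
    · simp only [HasInv]; omega
  · have : one.1 = 1 := rfl
    simp only [HasInv, skewSum_fst]; omega

theorem skewSum_one_injective {u v : SizedPerm} (h : skewSum u one = skewSum v one) : u = v := by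
  have hs : u.1 = v.1 := by
    have := congrArg Sigma.fst h
    simpa using this
  refine ext_inv hs fun i j => ?_
  have h₁ := inv_skewSum_one u (i + 1) (j + 1)
  have h₂ := inv_skewSum_one v (i + 1) (j + 1)
  rw [h, h₂] at h₁
  simpa using h₁.symm

/-- A decomposition of `w` as a direct sum with a first summand of size `k` means that no inversion
leads from the first `k` values to the other values. -/
theorem not_inv_of_eq_directSum {u v w : SizedPerm} (h : w = directSum u v) {i j : ℕ}
    (hi : i < u.1) (hj : u.1 ≤ j) : ¬ HasInv w i j := by
  rw [h, inv_directSum]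
  simp only [HasInv]
  omega

/-- `u ⊖ 1` is indecomposable, as the smallest value comes last. -/
theorem indecomposable_skewSum_one (u : SizedPerm) : Indecomposable (skewSum u one) := by
  refine ⟨Nat.le_add_left _ _, ?_⟩
  rintro ⟨a, b, ha, hb, h⟩
  have hs : u.1 + 1 = a.1 + b.1 := congrArg Sigma.fst h
  change a.1 < u.1 + 1 at ha
  change b.1 < u.1 + 1 at hb
  refine not_inv_of_eq_directSum h (i := 0) (j := a.1) (by omega) le_rfl ?_
  rw [inv_skewSum_one]
  omega

/-- First summands of equal size of direct sums are equal, and so are the second summands. -/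
theorem directSum_injective {u v u' v' : SizedPerm} (h : directSum u v = directSum u' v')
    (hs : u.1 = u'.1) : u = u' ∧ v = v' := by
  have hs' : v.1 = v'.1 := by
    have := congrArg Sigma.fst h
    simp only [directSum_fst] at this
    omega
  have hv := fun i => congrArg (val · i) h
  simp only [val_directSum, ← hs] at hv
  refine ⟨ext_val hs fun i hi => by simpa [hi] using hv i, ext_val hs' fun i hi => ?_⟩
  simpa using hv (u.1 + i)

theorem directSum_nil (u : SizedPerm) : directSum u ⟨0, Equiv.refl _⟩ = u := by
  refine ext_val rfl fun i hi => ?_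
  exact (val_directSum _ _ _).trans (if_pos hi)

theorem nil_directSum (u : SizedPerm) : directSum ⟨0, Equiv.refl _⟩ u = u := by
  refine ext_val (Nat.zero_add _) fun i hi => ?_
  simp [val_directSum]

theorem directSum_assoc (u v w : SizedPerm) :
    directSum (directSum u v) w = directSum u (directSum v w) := by
  refine ext_val (Nat.add_assoc _ _ _) fun i hi => ?_
  simp only [val_directSum, directSum_fst]
  split_ifs
  any_goals omega
  rw [Nat.sub_sub, Nat.add_assoc]

theorem directSumList_append (l l' : List SizedPerm) :
    directSumList (l ++ l') = directSum (directSumList l) (directSumList l') := by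
  induction l with
  | nil => exact (nil_directSum _).symm
  | cons u l ih =>
    change directSum u (directSumList (l ++ l')) = _
    rw [ih, ← directSum_assoc]
    rfl

/-- Of two first summands of the same permutation, a longer one decomposes: the part of `u'` after
`u` would be an initial segment of `v`. -/
theorem fst_le_of_directSum_eq {u v u' v' : SizedPerm} (h : directSum u v = directSum u' v')
    (hu : 0 < u.1) (hu' : Indecomposable u') : u'.1 ≤ u.1 := by
  by_contra! hlt
  have hs := congrArg Sigma.fst h
  simp only [directSum_fst] at hs
  -- The remaining values of `u'` form an initial segment of `v`.
  have hv := fun i => congrArg (val · i) h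
  have hp := fun i => congrArg (pos · i) h
  simp only [val_directSum, pos_directSum] at hv hp
  have hval : ∀ i, i < u'.1 - u.1 → val v i < u'.1 - u.1 := by
    intro i hi
    have h₁ := hv (u.1 + i)
    rw [if_neg (by omega), if_pos (by omega)] at h₁
    simp only [Nat.add_sub_cancel_left] at h₁
    have h₂ : val u' (u.1 + i) < u'.1 := by simp [val, show u.1 + i < u'.1 by omega]
    omega
  have hpos : ∀ i, i < u'.1 - u.1 → pos v i < u'.1 - u.1 := by
    intro i hi
    have h₁ := hp (u.1 + i)
    rw [if_neg (by omega), if_pos (by omega)] at h₁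
    simp only [Nat.add_sub_cancel_left] at h₁
    have h₂ := u'.pos_lt (i := u.1 + i) (by omega)
    omega
  have hvs : ∀ i, i < u'.1 - u.1 → i < v.1 := fun i hi => by omega
  let x : SizedPerm := ⟨u'.1 - u.1,
    { toFun := fun i => ⟨val v i, hval i i.2⟩
      invFun := fun i => ⟨pos v i, hpos i i.2⟩
      left_inv := fun i => by
        ext
        have := hvs i i.2
        simp [val, pos, this]
      right_inv := fun i => by
        ext
        have := hvs i i.2
        simp [val, pos, this] }⟩
  refine hu'.2 ⟨u, x, hlt, by change u'.1 - u.1 < u'.1; omega, ext_val ?_ fun i hi => ?_⟩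
  · change _ = u.1 + (u'.1 - u.1); omega
  · have h₁ := hv i
    rw [if_pos hi] at h₁
    rw [← h₁, val_directSum]
    split_ifs with h₂
    · rfl
    · congr 1
      exact (val_fin x ⟨i - u.1, by change i - u.1 < u'.1 - u.1; omega⟩).symm

theorem components_unique {l l' : List SizedPerm} (hl : ∀ u ∈ l, Indecomposable u)
    (hl' : ∀ u ∈ l', Indecomposable u) (h : directSumList l = directSumList l') : l = l' := by
  induction l generalizing l' with
  | nil =>
    cases l' with
    | nil => rfl
    | cons u' l' =>
      have h₁ : 0 = u'.1 + (directSumList l').1 := congrArg Sigma.fst h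
      have h₂ := (hl' u' (by simp)).1
      omega
  | cons u l ih =>
    cases l' with
    | nil =>
      have h₁ : u.1 + (directSumList l).1 = 0 := congrArg Sigma.fst h
      have h₂ := (hl u (by simp)).1
      omega
    | cons u' l' =>
      have hu := hl u (by simp)
      have hu' := hl' u' (by simp)
      have h : directSum u (directSumList l) = directSum u' (directSumList l') := h
      obtain ⟨rfl, h'⟩ := directSum_injective h
        (le_antisymm (fst_le_of_directSum_eq h.symm hu'.1 hu) (fst_le_of_directSum_eq h hu.1 hu'))
      rw [ih (fun v hv => hl v (by simp [hv])) (fun v hv => hl' v (by simp [hv])) h']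

end SizedPerm

/-! ### Forests as permutations -/

namespace PlaneForest

open SizedPerm

/-- The permutation whose one-line notation lists the nodes of the forest in postorder, where the
nodes are numbered in preorder. -/
def perm : PlaneForest → SizedPerm
  | nil => ⟨0, Equiv.refl _⟩
  | snoc F G => directSum F.perm (skewSum G.perm one)

@[simp] theorem perm_fst (F : PlaneForest) : F.perm.1 = F.size := by
  induction F with
  | nil => rfl
  | snoc F G ihF ihG =>
    change F.perm.1 + (G.perm.1 + 1) = F.size + G.size + 1
    omega

theorem inv_perm (F : PlaneForest) (i j : ℕ) : HasInv F.perm i j ↔ i < j ∧ j ≤ i + F.desc i := by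
  induction F generalizing i j with
  | nil => simp only [HasInv, perm, desc]; omega
  | snoc F G ihF ihG =>
    simp only [perm, inv_directSum, inv_skewSum_one, ihF, ihG, perm_fst, desc]
    split_ifs with h₁ h₂
    · omega
    · have := F.desc_of_size_le (i := i) (by omega)
      omega
    · have := F.desc_of_size_le (i := i) (by omega)
      omega

theorem perm_append (F G : PlaneForest) : (F.append G).perm = directSum F.perm G.perm := by
  induction G with
  | nil => exact (directSum_nil _).symm
  | snoc A B ihA _ => rw [append, perm, ihA, directSum_assoc]; rfl

theorem perm_tree (G : PlaneForest) : (snoc nil G).perm = skewSum G.perm one := nil_directSum _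

/-- The list of the permutations of the trees of a forest. -/
def components : PlaneForest → List SizedPerm
  | nil => []
  | snoc F G => F.components ++ [skewSum G.perm one]

theorem length_components (F : PlaneForest) : F.components.length = F.numTrees := by
  induction F with
  | nil => rfl
  | snoc F G ihF _ => simp [components, numTrees, ihF]

theorem isComponents (F : PlaneForest) : IsComponents F.perm F.components := by
  induction F with
  | nil => exact ⟨by simp [components], rfl⟩
  | snoc F G ihF _ =>
    refine ⟨fun u hu => ?_, ?_⟩
    · rcases List.mem_append.1 hu with hu | hu
      · exact ihF.1 u hu
      · rw [List.mem_singleton.1 hu]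
        exact indecomposable_skewSum_one _
    · rw [components, directSumList_append, ← ihF.2, perm]
      congr 1
      exact (directSum_nil _).symm

theorem hasEvenlyManyComponents_iff (F : PlaneForest) :
    HasEvenlyManyComponents F.perm ↔ Even F.numTrees := by
  rw [← length_components]
  refine ⟨?_, fun h => ⟨_, F.isComponents, h⟩⟩
  rintro ⟨l, ⟨hl, hl'⟩, heven⟩
  rwa [components_unique F.isComponents.1 hl (F.isComponents.2.symm.trans hl')]

theorem perm_injective {F F' : PlaneForest} (h : F.perm = F'.perm) : F = F' := by
  refine eq_of_desc_eq (by rw [← perm_fst, h, perm_fst]) fun i => ?_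
  have h₁ := F.inv_perm i (i + F.desc i)
  have h₂ := F.inv_perm i (i + F'.desc i)
  have h₃ := F'.inv_perm i (i + F.desc i)
  have h₄ := F'.inv_perm i (i + F'.desc i)
  rw [h] at h₁ h₂
  rw [h₃] at h₁
  rw [h₄] at h₂
  omega

theorem avoids312_perm (F : PlaneForest) : Avoids312 F.perm.2 := by
  rintro ⟨a, b, c, hab, hbc, h₁, h₂⟩
  have h₃ : HasInv F.perm (F.perm.2 b) (F.perm.2 a) := by
    rw [inv_fin]
    exact ⟨h₁.trans h₂, by simpa using hab⟩
  have h₄ : HasInv F.perm (F.perm.2 b) (F.perm.2 c) := by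
    rw [inv_perm] at h₃ ⊢
    exact ⟨h₁, (Fin.val_le_of_le h₂.le).trans h₃.2⟩
  rw [inv_fin] at h₄
  have := h₄.2
  simp only [Equiv.symm_apply_apply] at this
  exact absurd hbc this.not_gt

/-- Every 312-avoiding permutation comes from a forest: the number of descendants of `i` is the
number of values greater than `i` that stand before `i`; these values are consecutive. -/
theorem exists_perm_eq {w : SizedPerm} (hw : Avoids312 w.2) : ∃ F : PlaneForest, F.perm = w := by
  have hdown : ∀ i k j, i < k → k ≤ j → HasInv w i j → HasInv w i k := by
    rintro i k j hik hkj ⟨hij, hj, h⟩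
    rcases hkj.eq_or_lt with rfl | hkj
    · exact ⟨hij, hj, h⟩
    · refine ⟨hik, by omega, ?_⟩
      by_contra hc
      have hne : pos w i ≠ pos w k := fun e => hik.ne (w.pos_injective (by omega) (by omega) e)
      refine hw ⟨w.2.symm ⟨j, hj⟩, w.2.symm ⟨i, by omega⟩, w.2.symm ⟨k, by omega⟩, ?_, ?_, ?_, ?_⟩
      · rw [Fin.lt_def, ← pos_fin, ← pos_fin]
        exact h
      · rw [Fin.lt_def, ← pos_fin, ← pos_fin]
        exact lt_of_le_of_ne (not_lt.1 hc) hne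
      · simpa using hik
      · simpa using hkj
  classical
  let d : ℕ → ℕ := fun i => Nat.findGreatest (fun k => HasInv w i (i + k)) w.1
  have hd₁ : ∀ i j, HasInv w i j → j ≤ i + d i := by
    intro i j h
    have h₁ := h.1
    have h₂ := h.2.1
    have : j - i ≤ d i := Nat.le_findGreatest (by omega) (by rwa [Nat.add_sub_cancel' h₁.le])
    omega
  have hd₂ : ∀ i, 0 < d i → HasInv w i (i + d i) := fun i hi =>
    Nat.findGreatest_of_ne_zero (P := fun k => HasInv w i (i + k)) (n := w.1) rfl hi.ne'
  have hd : ∀ i j, HasInv w i j ↔ i < j ∧ j ≤ i + d i := fun i j =>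
    ⟨fun h => ⟨h.1, hd₁ i j h⟩, fun h => hdown i j _ h.1 h.2 (hd₂ i (by omega))⟩
  obtain ⟨F, hF, hF'⟩ := exists_desc_eq w.1 d
    (fun i hi => by
      rcases Nat.eq_zero_or_pos (d i) with h | h
      · omega
      · exact (hd₂ i h).2.1)
    (fun i k hik hk => by
      rcases Nat.eq_zero_or_pos (d k) with h | h
      · omega
      · have h₁ := hd₂ k h
        have h₂ := (hd i k).2 ⟨hik, hk⟩
        exact hd₁ _ _ ⟨by omega, h₁.2.1, h₁.2.2.trans h₂.2.2⟩)
  refine ⟨F, ext_inv (by rw [perm_fst, hF]) fun i j => ?_⟩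
  rw [inv_perm]
  by_cases hi : i < w.1
  · rw [hF' i hi, hd]
  · rw [desc_of_size_le _ (by omega)]
    simp only [HasInv]
    omega

end PlaneForest

/-! ### Ungar games in finite posets -/

section Ungar

variable {L : Type*} [PartialOrder L]

theorem IsNontrivialUngarMove.lt {x y : L} (h : IsNontrivialUngarMove x y) : y < x := by
  obtain ⟨T, hT, ⟨t, ht⟩, hy⟩ := h
  exact (hy.1 (Or.inr ht)).trans_lt (hT ht).lt

theorem covBy_Iic_iff {a : L} {x y : Set.Iic a} : x ⋖ y ↔ (x : L) ⋖ y :=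
  (Set.OrdConnected.apply_covBy_apply_iff (OrderEmbedding.subtype (· ∈ Set.Iic a))
    (by
      have h : Set.range (OrderEmbedding.subtype (· ∈ Set.Iic a)) = Set.Iic a := Subtype.range_coe
      rw [h]
      exact Set.ordConnected_Iic)).symm

theorem isGLB_Iic_iff {a : L} {S : Set (Set.Iic a)} (hS : S.Nonempty) {y : Set.Iic a} :
    IsGLB S y ↔ IsGLB (Subtype.val '' S) (y : L) := by
  obtain ⟨s, hs⟩ := hS
  constructor
  · rintro ⟨h₁, h₂⟩
    refine ⟨?_, fun z hz => ?_⟩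
    · rintro _ ⟨t, ht, rfl⟩
      exact h₁ ht
    · exact @h₂ ⟨z, (hz ⟨s, hs, rfl⟩).trans s.2⟩ fun t ht => hz ⟨t, ht, rfl⟩
  · rintro ⟨h₁, h₂⟩
    refine ⟨fun t ht => h₁ ⟨t, ht, rfl⟩, fun z hz => h₂ ?_⟩
    rintro _ ⟨t, ht, rfl⟩
    exact hz ht

theorem isNontrivialUngarMove_Iic_iff {a : L} {x y : Set.Iic a} :
    IsNontrivialUngarMove x y ↔ IsNontrivialUngarMove (x : L) y := by
  constructor
  · rintro ⟨T, hT, hne, hy⟩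
    refine ⟨Subtype.val '' T, ?_, hne.image _, ?_⟩
    · rintro _ ⟨t, ht, rfl⟩
      exact covBy_Iic_iff.1 (hT ht)
    · rw [isGLB_Iic_iff ⟨x, by simp⟩] at hy
      simpa [Set.image_insert_eq] using hy
  · rintro ⟨T, hT, hne, hy⟩
    have himage : Subtype.val '' (Subtype.val ⁻¹' T : Set (Set.Iic a)) = T := by
      rw [Subtype.image_preimage_coe, Set.inter_eq_right]
      exact fun t ht => (hT ht).le.trans x.2
    refine ⟨Subtype.val ⁻¹' T, fun t ht => covBy_Iic_iff.2 (hT ht), ?_, ?_⟩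
    · rw [← himage] at hne
      exact hne.of_image
    · rw [isGLB_Iic_iff ⟨x, by simp⟩, Set.image_union, himage, Set.image_singleton]
      exact hy

theorem moverWins_Iic_iff {a : L} {x : Set.Iic a} : MoverWins x ↔ MoverWins (x : L) := by
  constructor
  · intro h
    induction h with
    | intro x y move _ ih =>
      exact .intro _ _ (isNontrivialUngarMove_Iic_iff.1 move) fun z hz =>
        ih ⟨z, hz.lt.le.trans y.2⟩ (isNontrivialUngarMove_Iic_iff.2 hz)
  · intro h
    obtain ⟨x, hx⟩ := x
    change MoverWins x at h
    induction h with
    | intro x y move _ ih =>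
      exact .intro _ ⟨y, move.lt.le.trans hx⟩ (isNontrivialUngarMove_Iic_iff.2 move) fun z hz =>
        ih z (isNontrivialUngarMove_Iic_iff.1 hz) z.2

theorem isEetaWin_iff (x : L) : IsEetaWin x ↔ ¬ MoverWins x :=
  not_congr moverWins_Iic_iff

/-- A set of positions that no move preserves and that is reached by a move from each of the other
positions consists of the positions in which the player to move loses. -/
theorem not_moverWins_iff [Finite L] (P : L → Prop)
    (hP : ∀ x y, P x → IsNontrivialUngarMove x y → ¬ P y)
    (hP' : ∀ x, ¬ P x → ∃ y, IsNontrivialUngarMove x y ∧ P y) (x : L) : ¬ MoverWins x ↔ P x := by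
  rw [not_iff_comm]
  constructor
  · intro h
    induction x using WellFoundedLT.induction with
    | _ x ih =>
      obtain ⟨y, hxy, hy⟩ := hP' x h
      exact .intro x y hxy fun z hyz => ih z (hyz.lt.trans hxy.lt) (hP y z hy hyz)
  · intro h hx
    induction h with
    | intro x y move _ ih =>
      obtain ⟨z, hz, hz'⟩ := hP' y (hP x y hx move)
      exact ih z hz hz'

end Ungar

/-! ### The Tamari lattice as a lattice of forests -/

namespace PlaneForest

/-- A forest `Z` that has fewer descendants than `F` at `i`, but not at any later node, lacks the
last child of `i`. -/
theorem desc_le_shortDesc {F Z : PlaneForest} {i : ℕ} (hi : Z.desc i < F.desc i)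
    (h : ∀ k, i < k → F.desc k ≤ Z.desc k) : Z.desc i ≤ F.shortDesc i := by
  by_contra! hlt
  have h₁ := F.desc_last_child (by omega : 0 < F.desc i)
  have h₂ := h (i + F.shortDesc i + 1) (by omega)
  have h₃ := Z.desc_nested (i := i) (k := i + F.shortDesc i + 1) (by omega) (by omega)
  omega

end PlaneForest

namespace Tam

open PlaneForest SizedPerm

variable {n : ℕ}

/-- The forest of a 312-avoiding permutation. -/
noncomputable def forest (w : Tam n) : PlaneForest :=
  (exists_perm_eq (w := ⟨n, w.1⟩) w.2).choose

theorem perm_forest (w : Tam n) : w.forest.perm = ⟨n, w.1⟩ :=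
  (exists_perm_eq (w := ⟨n, w.1⟩) w.2).choose_spec

theorem size_forest (w : Tam n) : w.forest.size = n := by
  rw [← perm_fst, perm_forest]

theorem val_perm_forest (w : Tam n) (i : Fin n) : val w.forest.perm i = w.1 i := by
  rw [perm_forest]
  exact val_fin ⟨n, w.1⟩ i

theorem forest_injective {x y : Tam n} (h : x.forest = y.forest) : x = y := by
  have := x.perm_forest.symm.trans (h ▸ y.perm_forest)
  exact Subtype.ext (by simpa using this)

theorem forest_eq_of_perm_eq {F : PlaneForest} {w : Tam n} (h : F.perm = ⟨n, w.1⟩) :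
    w.forest = F :=
  perm_injective (w.perm_forest.trans h.symm)

theorem exists_forest_eq {F : PlaneForest} (h : F.size = n) : ∃ w : Tam n, w.forest = F := by
  rw [← perm_fst] at h
  subst h
  exact ⟨⟨F.perm.2, F.avoids312_perm⟩, forest_eq_of_perm_eq rfl⟩

theorem le_iff {x y : Tam n} : x ≤ y ↔ ∀ i, x.forest.desc i ≤ y.forest.desc i := by
  have hinv : ∀ (w : Tam n) (i j : Fin n),
      IsInversion w.1 i j ↔ (i : ℕ) < j ∧ (j : ℕ) ≤ i + w.forest.desc i := by
    intro w i j
    rw [← inv_perm, perm_forest]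
    exact (inv_fin ⟨n, w.1⟩ i j).symm
  constructor
  · intro h i
    by_cases hi : i < n
    · by_contra! hlt
      have := x.forest.desc_add_lt (i := i) (by rwa [size_forest])
      rw [size_forest] at this
      have := h ⟨i, hi⟩ ⟨i + x.forest.desc i, this⟩
      rw [hinv, hinv] at this
      have := this ⟨by dsimp only; omega, by dsimp only; omega⟩
      dsimp only at this
      omega
    · rw [desc_of_size_le _ (by rw [size_forest]; omega)]
      exact Nat.zero_le _
  · intro h i j hij
    rw [hinv] at hij ⊢
    have := h i
    omega

theorem ext_desc {x y : Tam n} (h : ∀ i, x.forest.desc i = y.forest.desc i) : x = y :=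
  le_antisymm (le_iff.2 fun i => (h i).le) (le_iff.2 fun i => (h i).ge)

/-- The lower covers of `x` arise by detaching the last child of a single node. -/
theorem covBy_iff {t x : Tam n} : t ⋖ x ↔ ∃ i, 0 < x.forest.desc i ∧
    ∀ k, t.forest.desc k = if k = i then x.forest.shortDesc k else x.forest.desc k := by
  constructor
  · intro h
    have hle := le_iff.1 h.le
    have hex : ∃ i, i ≤ n ∧ t.forest.desc i < x.forest.desc i := by
      by_contra! hc
      refine h.lt.not_ge (le_iff.2 fun i => ?_)
      by_cases hi : i ≤ n
      · exact hc i hi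
      · rw [desc_of_size_le _ (by rw [size_forest]; omega)]
        exact Nat.zero_le _
    classical
    obtain ⟨m, hm, hm'⟩ := hex
    -- the last node that loses descendants
    have hi := Nat.findGreatest_spec (P := fun i => t.forest.desc i < x.forest.desc i) hm hm'
    have hmax : ∀ k, Nat.findGreatest (fun i => t.forest.desc i < x.forest.desc i) n < k →
        x.forest.desc k ≤ t.forest.desc k := by
      intro k hk
      by_cases hkn : k ≤ n
      · exact not_lt.1 (Nat.findGreatest_is_greatest
          (P := fun i => t.forest.desc i < x.forest.desc i) hk hkn)
      · rw [desc_of_size_le _ (by rw [size_forest]; omega)]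
        exact Nat.zero_le _
    generalize Nat.findGreatest (fun i => t.forest.desc i < x.forest.desc i) n = i at hi hmax
    obtain ⟨F, hF, hF'⟩ := x.forest.exists_move_desc_eq {i}
    obtain ⟨c, rfl⟩ := exists_forest_eq (hF.size_eq.trans x.size_forest)
    have htc : t ≤ c := le_iff.2 fun k => by
      rw [hF']
      split_ifs with hk
      · obtain rfl : k = i := hk
        exact desc_le_shortDesc hi hmax
      · exact hle k
    have hcx : c < x := by
      refine lt_of_le_of_ne (le_iff.2 fun k => ?_) ?_
      · rw [hF']
        split_ifs
        · exact shortDesc_le _ _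
        · exact le_rfl
      · rintro rfl
        have := hF' i
        rw [if_pos (Set.mem_singleton i)] at this
        have := c.forest.shortDesc_lt (i := i) (by omega)
        omega
    obtain rfl : t = c := htc.eq_of_not_lt fun h' => h.2 h' hcx
    exact ⟨i, by omega, hF'⟩
  · rintro ⟨i, hi, h⟩
    have hlt := x.forest.shortDesc_lt hi
    have hle : t ≤ x := le_iff.2 fun k => by
      rw [h]
      split_ifs
      · exact shortDesc_le _ _
      · exact le_rfl
    refine ⟨lt_of_le_of_ne hle ?_, fun z htz hzx => ?_⟩
    · rintro rfl
      have := h i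
      rw [if_pos rfl] at this
      omega
    · have h₁ := le_iff.1 htz.le
      have h₂ := le_iff.1 hzx.le
      have h₃ : ∀ k, k ≠ i → z.forest.desc k = x.forest.desc k := fun k hk => by
        have := h₁ k
        rw [h, if_neg hk] at this
        exact le_antisymm (h₂ k) this
      have h₄ : z.forest.desc i < x.forest.desc i := by
        refine lt_of_le_of_ne (h₂ i) fun he => hzx.ne (ext_desc fun k => ?_)
        by_cases hk : k = i
        · rw [hk, he]
        · exact h₃ k hk
      refine htz.not_ge (le_iff.2 fun k => ?_)
      rw [h]
      split_ifs with hk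
      · subst hk
        exact desc_le_shortDesc h₄ fun l hl => (h₃ l hl.ne').ge
      · exact (h₃ k hk).le

theorem isNontrivialUngarMove_iff {x y : Tam n} :
    IsNontrivialUngarMove x y ↔ y ≠ x ∧ Move x.forest y.forest := by
  classical
  constructor
  · intro hxy
    refine ⟨hxy.lt.ne, ?_⟩
    obtain ⟨T, hT, _, hy⟩ := hxy
    obtain ⟨F, hF, hF'⟩ := x.forest.exists_move_desc_eq
      {i | ∃ t ∈ T, t.forest.desc i < x.forest.desc i}
    obtain ⟨m, rfl⟩ := exists_forest_eq (hF.size_eq.trans x.size_forest)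
    have hm : IsGLB ({x} ∪ T) m := by
      refine ⟨?_, fun z hz => le_iff.2 fun i => ?_⟩
      · rintro t (rfl | ht)
        · refine le_iff.2 fun i => ?_
          rw [hF']
          split_ifs
          · exact shortDesc_le _ _
          · exact le_rfl
        · refine le_iff.2 fun i => ?_
          obtain ⟨j, hj, htj⟩ := covBy_iff.1 (hT ht)
          rw [hF', htj]
          split_ifs with h₁ h₂ h₂
          · exact le_rfl
          · exact shortDesc_le _ _
          · subst h₂
            refine absurd ⟨t, ht, ?_⟩ h₁
            rw [htj, if_pos rfl]
            exact shortDesc_lt _ hj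
          · exact le_rfl
      · rw [hF']
        split_ifs with h
        · obtain ⟨t, ht, hti⟩ := h
          have hzt := le_iff.1 (hz (Or.inr ht)) i
          obtain ⟨j, hj, htj⟩ := covBy_iff.1 (hT ht)
          rw [htj] at hti hzt
          split_ifs at hti hzt
          · exact hzt
          · exact absurd hti (lt_irrefl _)
        · exact le_iff.1 (hz (Or.inl rfl)) i
    rwa [hy.unique hm]
  · rintro ⟨hne, hxy⟩
    have hdesc := hxy.desc_eq_or
    have hle : y ≤ x := le_iff.2 fun i => by
      rcases hdesc i with h | h
      · exact h.le
      · exact h.le.trans (shortDesc_le _ _)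
    have key : ∀ i, y.forest.desc i ≠ x.forest.desc i →
        ∃ t : Tam n, t ⋖ x ∧ y ≤ t ∧ t.forest.desc i = y.forest.desc i := by
      intro i hi
      obtain ⟨F, hF, hF'⟩ := x.forest.exists_move_desc_eq {i}
      obtain ⟨t, rfl⟩ := exists_forest_eq (hF.size_eq.trans x.size_forest)
      have hyi := (hdesc i).resolve_left hi
      refine ⟨t, covBy_iff.2 ⟨i, ?_, hF'⟩, le_iff.2 fun k => ?_, ?_⟩
      · have := le_iff.1 hle i
        omega
      · rw [hF']
        split_ifs with hk
        · obtain rfl : k = i := hk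
          exact hyi.le
        · exact le_iff.1 hle k
      · rw [hF', if_pos (Set.mem_singleton i), hyi]
    refine ⟨{t | t ⋖ x ∧ y ≤ t}, fun t ht => ht.1, ?_, ?_, fun z hz => le_iff.2 fun i => ?_⟩
    · obtain ⟨i, hi⟩ : ∃ i, y.forest.desc i ≠ x.forest.desc i := by
        by_contra! hc
        exact hne (ext_desc hc)
      obtain ⟨t, h₁, h₂, _⟩ := key i hi
      exact ⟨t, h₁, h₂⟩
    · rintro t (rfl | ht)
      · exact hle
      · exact ht.2
    · by_cases hi : y.forest.desc i = x.forest.desc i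
      · rw [hi]
        exact le_iff.1 (hz (Or.inl rfl)) i
      · obtain ⟨t, h₁, h₂, h₃⟩ := key i hi
        rw [← h₃]
        exact le_iff.1 (hz (Or.inr ⟨h₁, h₂⟩)) i

theorem isEetaWin_iff_losing (w : Tam n) : IsEetaWin w ↔ w.forest.Losing := by
  have : Finite (Tam n) := Subtype.finite
  rw [isEetaWin_iff]
  refine not_moverWins_iff (fun x : Tam n => x.forest.Losing) (fun x y hx hxy hy => ?_)
    (fun x hx => ?_) w
  · rw [isNontrivialUngarMove_iff] at hxy
    exact hxy.1 (forest_injective (hx.eq_of_move hxy.2 hy))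
  · obtain ⟨F, hF, hF'⟩ := x.forest.exists_move_losing
    obtain ⟨y, rfl⟩ := exists_forest_eq (hF.size_eq.trans x.size_forest)
    refine ⟨y, isNontrivialUngarMove_iff.2 ⟨?_, hF⟩, hF'⟩
    rintro rfl
    exact hx hF'

/-! ### Even-districted permutations -/

theorem forest_eq_tree_of_indecomposable (w : Tam n) (hw : Indecomposable ⟨n, w.1⟩) :
    ∃ G, w.forest = snoc nil G := by
  have hs := w.size_forest
  have hp := w.perm_forest
  cases h : w.forest with
  | nil =>
    have : 1 ≤ n := hw.1
    simp only [h, size] at hs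
    omega
  | snoc F G =>
    cases F with
    | nil => exact ⟨G, rfl⟩
    | snoc A B =>
      rw [h] at hs hp
      simp only [size] at hs
      refine absurd ⟨_, _, ?_, ?_, hp.symm⟩ hw.2
      · simp only [perm_fst, size]; omega
      · simp only [skewSum_fst, perm_fst, one]; omega

end Tam

theorem standardizationFun_lt_iff {k : ℕ} (x : Fin k → ℕ) (i j : Fin k) :
    standardizationFun x i < standardizationFun x j ↔ x i < x j := by
  have key : ∀ i j : Fin k, x i ≤ x j → standardizationFun x i ≤ standardizationFun x j := by
    intro i j hij
    refine Fin.mk_le_mk.mpr (Finset.card_le_card fun a ha => ?_)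
    simp only [Finset.mem_filter, Finset.mem_univ, true_and] at ha ⊢
    omega
  constructor
  · intro h
    by_contra! hc
    exact h.not_ge (key j i hc)
  · intro h
    refine lt_of_le_of_ne (key i j h.le) fun he => ?_
    have hss : (Finset.univ.filter fun a => x a < x i) ⊂ Finset.univ.filter fun a => x a < x j := by
      refine Finset.ssubset_iff_of_subset (fun a ha => ?_) |>.mpr ⟨i, by simpa using h, by simp⟩
      simp only [Finset.mem_filter, Finset.mem_univ, true_and] at ha ⊢
      omega
    exact (Finset.card_lt_card hss).ne (congrArg Fin.val he)

/-- A permutation is the standardization of every word in the same relative order. -/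
theorem eq_standardization {k : ℕ} (σ : Equiv.Perm (Fin k)) (x : Fin k → ℕ)
    (hx : Function.Injective x) (h : ∀ i j, σ i < σ j ↔ x i < x j) : σ = standardization x hx := by
  have hmono : StrictMono (fun a : Fin k => standardization x hx (σ.symm a)) := by
    intro a b hab
    change standardizationFun x _ < standardizationFun x _
    rw [standardizationFun_lt_iff, ← h]
    simpa using hab
  have hid : (fun a : Fin k => standardization x hx (σ.symm a)) = id :=
    (StrictMono.range_inj hmono strictMono_id).mp
      (((standardization x hx).surjective.comp σ.symm.surjective).range_eq.trans
        Set.range_id.symm)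
  ext i
  have := congrFun hid (σ i)
  simp only [Equiv.symm_apply_apply, id] at this
  rw [this]

namespace Tam

open PlaneForest SizedPerm

/-- Deleting the last two letters of the permutation of a tree deletes the root and its last child,
leaving behind the children of that child. -/
theorem standardization_dropLastTwo_eq {n : ℕ} (w : Tam n) {A B : PlaneForest}
    (hw : w.forest = snoc nil (snoc A B)) (s : Tam (n - 2)) (hs : s.forest = A.append B) :
    s.1 = standardization (dropLastTwo w.1) (dropLastTwo_injective w.1) := by
  have hn : n = A.size + B.size + 2 := by
    rw [← w.size_forest, hw]
    simp only [size]
    omega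
  have hone : one.1 = 1 := rfl
  refine eq_standardization _ _ _ fun i j => ?_
  have hsv : ∀ i : Fin (n - 2), (s.1 i : ℕ) =
      if (i : ℕ) < A.size then val A.perm i else A.size + val B.perm (i - A.size) := by
    intro i
    rw [← val_perm_forest, hs, perm_append, val_directSum, perm_fst]
  have hwv : ∀ i : Fin (n - 2), dropLastTwo w.1 i =
      if (i : ℕ) < A.size then val A.perm i + 1 else A.size + val B.perm (i - A.size) + 2 := by
    intro i
    have hi := i.2
    rw [dropLastTwo, ← val_perm_forest, hw, perm_tree, val_skewSum,
      if_pos, perm, val_directSum]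
    · simp only [Fin.val_castLE, perm_fst, hone]
      split_ifs with h
      · omega
      · rw [val_skewSum, if_pos]
        · simp only [hone]; omega
        · simp only [perm_fst]; omega
        · simp only [perm_fst, hone]; omega
    · simp only [Fin.val_castLE, perm_fst, size]; omega
    · simp only [Fin.val_castLE, perm_fst, size, hone]; omega
  have hA : ∀ k : ℕ, k < A.size → val A.perm k < A.size := by
    intro k hk
    have hk' : k < A.perm.1 := by rwa [perm_fst]
    rw [val, dif_pos hk']
    exact (Fin.is_lt _).trans_eq (perm_fst A)
  rw [Fin.lt_def, hsv, hsv, hwv, hwv]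
  split_ifs with h₁ h₂ h₂
  · omega
  · have := hA i h₁
    omega
  · have := hA j h₂
    omega
  · omega

theorem evenDistricted_iff {n : ℕ} (w : Tam n) {G : PlaneForest} (hw : w.forest = snoc nil G) :
    EvenDistricted w ↔ (snoc nil G).Losing := by
  have hn : n = G.size + 1 := by
    rw [← w.size_forest, hw]
    simp only [size]
    omega
  have hp : (⟨n, w.1⟩ : SizedPerm) = skewSum G.perm one := by
    rw [← w.perm_forest, hw, perm_tree]
  have heven : (∃ w' : Tam (n - 1),
      (⟨n, w.1⟩ : SizedPerm) = skewSum ⟨n - 1, w'.1⟩ ⟨1, Equiv.refl _⟩ ∧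
        HasEvenlyManyComponents ⟨n - 1, w'.1⟩) ↔ Even G.numTrees := by
    rw [← hasEvenlyManyComponents_iff, hp]
    constructor
    · rintro ⟨w', h₁, h₂⟩
      rwa [skewSum_one_injective h₁]
    · intro h
      obtain ⟨w', hw'⟩ := exists_forest_eq (F := G) (n := n - 1) (by omega)
      refine ⟨w', ?_, ?_⟩ <;> rw [← w'.perm_forest, hw']
      · rfl
      · exact h
  unfold EvenDistricted
  rw [heven]
  cases G with
  | nil => simp [Losing, hn, size]
  | snoc A B =>
    simp only [size] at hn
    obtain ⟨s, hs⟩ := exists_forest_eq (F := A.append B) (n := n - 2) (by rw [size_append]; omega)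
    have hstd : (∃ s' : Tam (n - 2),
        s'.1 = standardization (dropLastTwo w.1) (dropLastTwo_injective w.1) ∧ IsEetaWin s') ↔
        A.Losing ∧ B.Losing := by
      rw [← losing_append, ← hs, ← isEetaWin_iff_losing]
      have hs' := standardization_dropLastTwo_eq w hw s hs
      constructor
      · rintro ⟨s', h₁, h₂⟩
        rwa [Subtype.ext (hs'.trans h₁.symm)]
      · exact fun h => ⟨s, hs', h⟩
    rw [hstd, losing_tree_snoc, numTrees, Nat.even_add_one, Nat.not_even_iff_odd]
    constructor
    · rintro (h | h)
      · omega
      · exact h.2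
    · intro h
      have : 0 < A.size := by
        cases A with
        | nil => simp [numTrees] at h
        | snoc => simp only [size]; omega
      exact .inr ⟨by omega, h⟩

end Tam

theorem proposition5p2 (n : ℕ) (w : Tam n) (hw : Indecomposable ⟨n, w.1⟩) :
    IsEetaWin w ↔ EvenDistricted w := by
  obtain ⟨G, hG⟩ := w.forest_eq_tree_of_indecomposable hw
  rw [w.isEetaWin_iff_losing, w.evenDistricted_iff hG, hG]
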